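/- **Theorem.** For a normal subgroup $N$ of a group $F$ let $\mathbf{n}$ denote the two-sided ideal of the integral group ring $\mathbb{Z}[F]$ generated by the elements $n-1$ with $n\in N$ (so $\mathbf r,\mathbf s,\mathbf t$ correspond to $R,S,T$). For an ideal $\mathfrak a$ of $\mathbb{Z}[F]$ put $D(F,\mathfrak a)=F\cap(1+\mathfrak a)=\{w\in F : w-1\in\mathfrak a\}$. Let $R,S,T$ be normal subgroups of a free group $F$ (of arbitrary rank) with $R\subseteq S$ and $R\subseteq T$. If $a\in D(F,\ \mathbf{srs}+\mathbf{trt})$, then $$a^2\in D(F,\ \mathbf{rrs}+\mathbf{srr}+\mathbf{rrt}+\mathbf{trr})\qquad\text{and}\qquad a^4\in[R,R,ST],$$ where $[R,R,ST]=[[R,R],ST]$ is the left-normed commutator subgroup, and juxtaposition and $+$ of ideals denote product and sum of two-sided ideals. -/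

import Mathlib

noncomputable section

/-- The element `g - 1` of the integral group ring `ℤ[G]`. -/
def grpSubOne {G : Type*} [Group G] (g : G) : MonoidAlgebra ℤ G :=
  MonoidAlgebra.of ℤ G g - 1

/-- The two-sided ideal `𝐧` of `ℤ[G]` generated by the elements `n - 1`, `n ∈ N`, that is, generated
by the augmentation ideal of `ℤ[N]`. It is regarded as an element of `Ideal ℤ[G]`, where products
and sums of ideals are available; a product `I * J` of two-sided ideals there is the set of all
finite sums of products `x * y` with `x ∈ I`, `y ∈ J`. -/
def relAugIdeal {G : Type*} [Group G] (N : Subgroup G) : Ideal (MonoidAlgebra ℤ G) :=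
  (TwoSidedIdeal.span {x : MonoidAlgebra ℤ G | ∃ n ∈ N, x = grpSubOne n}).asIdeal

/-- The subgroup `D(G, I) = G ∩ (1 + I)` of `G`, for an ideal `I` of `ℤ[G]`. -/
def dimSubgroup (G : Type*) [Group G] (I : Ideal (MonoidAlgebra ℤ G)) : Subgroup G where
  carrier := {g | grpSubOne g ∈ I}
  one_mem' := by
    simp only [Set.mem_ofPred_eq, grpSubOne, map_one, sub_self]
    exact I.zero_mem
  mul_mem' := by
    intro a b ha hb
    simp only [Set.mem_ofPred_eq] at ha hb ⊢
    have h : grpSubOne (a * b) = MonoidAlgebra.of ℤ G a * grpSubOne b + grpSubOne a := by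
      simp only [grpSubOne, map_mul]
      noncomm_ring
    rw [h]
    exact I.add_mem (I.mul_mem_left _ hb) ha
  inv_mem' := by
    intro a ha
    simp only [Set.mem_ofPred_eq] at ha ⊢
    have h1 : MonoidAlgebra.of ℤ G a⁻¹ * MonoidAlgebra.of ℤ G a = 1 := by
      rw [← map_mul, inv_mul_cancel, map_one]
    have h : grpSubOne a⁻¹ = -MonoidAlgebra.of ℤ G a⁻¹ * grpSubOne a := by
      simp only [grpSubOne, mul_sub, neg_mul, h1, mul_one]
      abel
    rw [h]
    exact I.mul_mem_left _ ha

end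

open MulAut (conjNormal)
open scoped commutatorElement IsMulCommutative

/-! Put `H = S ⊔ T`, again a free group; then `a - 1 ∈ 𝐡𝐫𝐡`, which forces `a ∈ [R,R]`. For an
invariant pairing `β` on `R`, freeness of `H` gives a function `η` on `H` whose linear extension
kills `𝐡𝐫𝐡` and whose deviation from additivity on `R` is `β v w - β w v`
(`exists_functional_of_invariantPairing`). On `[R,R]` the function `η - η 1` is a homomorphism
sending `[v,w]` to `2 (β v w - β w v)`. So if a homomorphism `cl` on `[R,R]` sends `[v,w]` to `β v w
- β w v`, then `2 • cl a = η a - η 1 = 0` (`two_nsmul_eq_zero_of_mem_commutator`).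

Two pairings finish the proof. For `(u - 1)(v - 1)` modulo the target ideal, `cl c` is the class of
`c - 1`, which gives `a ^ 2`. For `[u,v]` modulo `[[R,R],H]`, which is antisymmetric, `cl c` is
twice the class of `c`, which gives `a ^ 4`. -/

/-! ### Difference equations on a free group -/

theorem IsFreeGroup.eq_top_of_forall_of_mem {G : Type*} [Group G] [IsFreeGroup G]
    (K : Subgroup G) (h : ∀ i, IsFreeGroup.of (G := G) i ∈ K) : K = ⊤ := by
  have key : K.subtype.comp (IsFreeGroup.lift fun i => (⟨IsFreeGroup.of i, h i⟩ : K)) =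
      MonoidHom.id G := by
    apply IsFreeGroup.ext_hom
    intro i
    simp [IsFreeGroup.lift_of]
  rw [eq_top_iff]
  intro g _
  have := DFunLike.congr_fun key g
  rw [MonoidHom.id_apply] at this
  rw [← this]
  exact SetLike.coe_mem _

/-- A function on the edges of the left Cayley graph of a free group is the coboundary of a
function on the vertices. -/
theorem IsFreeGroup.exists_left_primitive {G B : Type*} [Group G] [IsFreeGroup G] [AddCommGroup B]
    (φ : G → G → B) :
    ∃ θ : G → B, ∀ i g, θ (IsFreeGroup.of i * g) - θ g = φ (IsFreeGroup.of i) g := by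
  -- Each generator moves along an edge and adds the value of `φ` there. Freeness extends this to an
  -- action, and the orbit of `(1, 0)` integrates `φ` along paths from `1`.
  let e : G → Equiv.Perm (G × B) := fun x =>
    { toFun := fun p => (x * p.1, p.2 + φ x p.1)
      invFun := fun p => (x⁻¹ * p.1, p.2 - φ x (x⁻¹ * p.1))
      left_inv := fun p => by simp
      right_inv := fun p => by simp }
  let f : G →* Equiv.Perm (G × B) := IsFreeGroup.lift fun i => e (IsFreeGroup.of i)
  have hf : ∀ i, f (IsFreeGroup.of i) = e (IsFreeGroup.of i) := fun i => IsFreeGroup.lift_of _ _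
  let K : Subgroup G :=
    { carrier := {w | ∀ p, (f w p).1 = w * p.1}
      one_mem' := fun p => by simp
      mul_mem' := fun {a b} ha hb p => by
        rw [map_mul, Equiv.Perm.mul_apply, ha, hb, mul_assoc]
      inv_mem' := fun {a} ha p => by
        have := ha (f a⁻¹ p)
        rw [← Equiv.Perm.mul_apply, ← map_mul, mul_inv_cancel, map_one, Equiv.Perm.one_apply] at this
        rw [this, inv_mul_cancel_left] }
  have hK : K = ⊤ := IsFreeGroup.eq_top_of_forall_of_mem K fun i p => by rw [hf]; rfl
  have hfst : ∀ w p, (f w p).1 = w * p.1 := fun w => (hK ▸ Subgroup.mem_top w : w ∈ K)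
  refine ⟨fun w => (f w (1, 0)).2, fun i g => ?_⟩
  have h1 : (f g (1, 0)).1 = g := by rw [hfst, mul_one]
  simp only [map_mul, Equiv.Perm.mul_apply, hf]
  change (f g (1, 0)).2 + φ _ (f g (1, 0)).1 - (f g (1, 0)).2 = _
  rw [h1, add_sub_cancel_left]

theorem IsFreeGroup.exists_right_primitive {G B : Type*} [Group G] [IsFreeGroup G]
    [AddCommGroup B] (φ : G → G → B) :
    ∃ θ : G → B, ∀ i g, θ (g * IsFreeGroup.of i) - θ g = φ (IsFreeGroup.of i) g := by
  obtain ⟨θ, hθ⟩ := IsFreeGroup.exists_left_primitive (fun x g => -φ x (x * g)⁻¹)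
  refine ⟨fun g => θ g⁻¹, fun i g => ?_⟩
  have := hθ i (g * IsFreeGroup.of i)⁻¹
  simp only [mul_inv_rev, mul_inv_cancel_left, inv_inv] at this ⊢
  rw [← neg_sub, this, neg_neg]

theorem IsFreeGroup.eq_one_of_left_invariant {G B : Type*} [Group G] [IsFreeGroup G]
    (f : G → B) (h : ∀ i g, f (IsFreeGroup.of i * g) = f g) (g : G) : f g = f 1 := by
  let K : Subgroup G :=
    { carrier := {w | ∀ g, f (w * g) = f g}
      one_mem' := fun p => by simp
      mul_mem' := fun {a b} ha hb p => by rw [mul_assoc, ha, hb]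
      inv_mem' := fun {a} ha p => by rw [← ha, mul_inv_cancel_left] }
  have hK : K = ⊤ := IsFreeGroup.eq_top_of_forall_of_mem K h
  have : g ∈ K := hK ▸ Subgroup.mem_top g
  rw [← this 1, mul_one]

/-! ### Invariant pairings -/

/-- A function `R × R → B`, additive in both variables and invariant under simultaneous
conjugation by elements of `G`. -/
structure IsInvariantPairing {G B : Type*} [Group G] [AddCommGroup B] (R : Subgroup G) [R.Normal]
    (β : R → R → B) : Prop where
  mul_left : ∀ u v w, β (u * v) w = β u w + β v w
  mul_right : ∀ u v w, β u (v * w) = β u v + β u w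
  conj : ∀ (g : G) u v, β (conjNormal g u) (conjNormal g v) = β u v

namespace IsInvariantPairing

variable {G B : Type*} [Group G] [AddCommGroup B] {R : Subgroup G} [R.Normal] {β : R → R → B}

theorem one_left (h : IsInvariantPairing R β) (v : R) : β 1 v = 0 := by
  simpa using h.mul_left 1 1 v

theorem one_right (h : IsInvariantPairing R β) (v : R) : β v 1 = 0 := by
  simpa using h.mul_right v 1 1

theorem inv_left (h : IsInvariantPairing R β) (u v : R) : β u⁻¹ v = -β u v := by
  rw [eq_neg_iff_add_eq_zero, ← h.mul_left, inv_mul_cancel, h.one_left]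

theorem inv_right (h : IsInvariantPairing R β) (u v : R) : β u v⁻¹ = -β u v := by
  rw [eq_neg_iff_add_eq_zero, ← h.mul_right, inv_mul_cancel, h.one_right]

theorem eq_zero_of_mem_commutator (h : IsInvariantPairing R β) {a : R} (ha : a ∈ commutator R)
    (b : R) : β a b = 0 ∧ β b a = 0 := by
  let f₁ : R →* Multiplicative B := MonoidHom.mk' (fun u => Multiplicative.ofAdd (β u b))
    fun u v => by rw [h.mul_left, ofAdd_add]
  let f₂ : R →* Multiplicative B := MonoidHom.mk' (fun u => Multiplicative.ofAdd (β b u))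
    fun u v => by rw [h.mul_right, ofAdd_add]
  have h₁ : f₁ a = 1 := Abelianization.commutator_subset_ker f₁ ha
  have h₂ : f₂ a = 1 := Abelianization.commutator_subset_ker f₂ ha
  exact ⟨h₁, h₂⟩

end IsInvariantPairing

/-! ### The density attached to a pairing -/

section

variable {G B : Type*} [Group G] [AddCommGroup B] {R : Subgroup G} [R.Normal]

/-- The obstruction to equivariance of a function `l : G → R` with `l (g * v) = l g * v`. -/
def equivarianceDefect (l : G → R) (y k : G) : R := l k * (conjNormal y (l (k * y)))⁻¹

/-- The edge function of which a primitive is to be found. -/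
def pairingDensity (β : R → R → B) (l : G → R) (y x g : G) : B :=
  β (conjNormal y (l (g * y) * (l (x * (g * y)))⁻¹)) (equivarianceDefect l y (x * g)) -
    β (equivarianceDefect l y g) (l g * (l (x * g))⁻¹)

variable {l : G → R}

theorem conjNormal_apply_mul_mul (hl : ∀ g (v : R), l (g * v) = l g * v)
    (y g : G) (v : R) :
    conjNormal y (l (g * v * y)) = conjNormal y (l (g * y)) * v := by
  have : g * v * y = g * y * (conjNormal y⁻¹ v : R) := by
    simp [mul_assoc]
  rw [this, hl, map_mul, ← MulAut.mul_apply, ← map_mul, mul_inv_cancel, map_one, MulAut.one_apply]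

theorem equivarianceDefect_mul_right (hl : ∀ g (v : R), l (g * v) = l g * v)
    (y k : G) (v : R) :
    equivarianceDefect l y (k * v) = equivarianceDefect l y k := by
  rw [equivarianceDefect, conjNormal_apply_mul_mul hl, hl, equivarianceDefect]
  group

theorem equivarianceDefect_of_mem (hl : ∀ g (v : R), l (g * v) = l g * v)
    (w : R) (k : G) : equivarianceDefect l w k = w⁻¹ := by
  rw [equivarianceDefect, hl]
  ext
  simp

/-- The density involves `l` only through defects, which are constant on cosets of `R`, and
quotients in which the factors `v` cancel. -/
theorem pairingDensity_mul_right (hl : ∀ g (v : R), l (g * v) = l g * v)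
    (β : R → R → B) (y x g : G) (v : R) :
    pairingDensity β l y x (g * v) = pairingDensity β l y x g := by
  have h1 : conjNormal y (l (x * (g * v * y))) = conjNormal y (l (x * (g * y))) * v := by
    have := conjNormal_apply_mul_mul hl y (x * g) v
    simpa only [mul_assoc] using this
  have h2 := conjNormal_apply_mul_mul hl y g v
  have h3 : equivarianceDefect l y (x * (g * v)) = equivarianceDefect l y (x * g) := by
    rw [← mul_assoc, equivarianceDefect_mul_right hl]
  have h4 : l (x * (g * v)) = l (x * g) * v := by rw [← mul_assoc, hl]
  simp only [pairingDensity, map_mul, map_inv, h1, h2, h3, h4, hl,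
    equivarianceDefect_mul_right hl]
  simp only [mul_inv_rev, mul_assoc, mul_inv_cancel_left]

/-- The failure of the cocycle rule in `y` is the difference, under `g ↦ x * g`, of a single
function of `g`. That function depends on `l` only through defects, so it is right `R`-invariant. -/
theorem pairingDensity_mul {β : R → R → B} (hβ : IsInvariantPairing R β) (y y' x g : G) :
    pairingDensity β l (y * y') x g - pairingDensity β l y x g - pairingDensity β l y' x (g * y) =
      β (conjNormal y (equivarianceDefect l y' (x * g * y))) (equivarianceDefect l y (x * g)) -
        β (conjNormal y (equivarianceDefect l y' (g * y))) (equivarianceDefect l y g) := by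
  have h1 : pairingDensity β l y' x (g * y) =
      β (conjNormal y (conjNormal y' (l (g * y * y') * (l (x * (g * y * y')))⁻¹)))
          (conjNormal y (equivarianceDefect l y' (x * (g * y)))) -
        β (conjNormal y (equivarianceDefect l y' (g * y)))
          (conjNormal y (l (g * y) * (l (x * (g * y)))⁻¹)) := by
    rw [hβ.conj, hβ.conj, pairingDensity]
  rw [h1]
  simp only [pairingDensity, equivarianceDefect, hβ.mul_left, hβ.mul_right, hβ.inv_left,
    hβ.inv_right, map_mul, map_inv, mul_assoc, MulAut.mul_apply]
  abel

/-- Since the defect of `w ∈ R` is the constant `w⁻¹`, the density has an explicit primitive; this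
is the source of the antisymmetrization of `β`. -/
theorem pairingDensity_of_mem (hl : ∀ g (v : R), l (g * v) = l g * v)
    {β : R → R → B} (hβ : IsInvariantPairing R β) (w : R) (x g : G) :
    pairingDensity β l w x g =
      (β (l (x * g)) w - β w (l (x * g))) - (β (l g) w - β w (l g)) := by
  have h1 : l (x * (g * w)) = l (x * g) * w := by rw [← mul_assoc, hl]
  simp only [pairingDensity, equivarianceDefect_of_mem hl, map_mul, map_inv, h1, hl,
    hβ.mul_left, hβ.mul_right, hβ.inv_left, hβ.inv_right, MulAut.conjNormal_val, MulAut.conj_apply]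
  abel

end

/-! ### Construction of the functional -/

theorem Subgroup.exists_right_equivariant {G : Type*} [Group G] (R : Subgroup G) :
    ∃ l : G → R, ∀ g (v : R), l (g * v) = l g * v := by
  have hq : ∀ g : G, (Quotient.out (g : G ⧸ R))⁻¹ * g ∈ R := fun g =>
    QuotientGroup.eq.mp (QuotientGroup.out_eq' _)
  refine ⟨fun g => ⟨_, hq g⟩, fun g v => ?_⟩
  ext
  simp only [QuotientGroup.mk_mul_of_mem g v.2, Subgroup.coe_mul, mul_assoc]

/-- Let `h` be the linear extension of `η` to `ℤ[G]`; then the first property says that `h` kills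
all elements `(x - 1) g (v - 1) (y - 1)` with `v ∈ R`, and the second one computes
`h ((v - 1) (w - 1))`. -/
theorem exists_functional_of_invariantPairing {G B : Type*} [Group G] [IsFreeGroup G]
    [AddCommGroup B] (R : Subgroup G) [R.Normal] {β : R → R → B} (hβ : IsInvariantPairing R β) :
    ∃ η : G → B,
      (∀ x y g : G, ∀ v ∈ R, η (x * g * v * y) - η (x * g * v) - (η (g * v * y) - η (g * v)) =
        η (x * g * y) - η (x * g) - (η (g * y) - η g)) ∧
      ∀ v w : R, η (v * w) - η v - (η w - η 1) = β v w - β w v := by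
  obtain ⟨l, hl⟩ := R.exists_right_equivariant
  -- Integrating the density on the left and then on the right gives `η` with prescribed mixed
  -- differences for generators; the rest extends the invariance to all `x` and `y`.
  choose θ hθ using fun y => IsFreeGroup.exists_left_primitive (pairingDensity β l y)
  obtain ⟨η, hη⟩ := IsFreeGroup.exists_right_primitive θ
  -- Both sides have the same left differences by `pairingDensity_mul`, so they differ by a
  -- constant.
  have hmul : ∀ y y' g, θ (y * y') g - θ y g - θ y' (g * y) -
      β (conjNormal y (equivarianceDefect l y' (g * y))) (equivarianceDefect l y g) =
      θ (y * y') 1 - θ y 1 - θ y' (1 * y) -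
      β (conjNormal y (equivarianceDefect l y' (1 * y))) (equivarianceDefect l y 1) := by
    intro y y'
    apply IsFreeGroup.eq_one_of_left_invariant (fun g => θ (y * y') g - θ y g - θ y' (g * y) -
      β (conjNormal y (equivarianceDefect l y' (g * y))) (equivarianceDefect l y g))
    intro i g
    have h := pairingDensity_mul (l := l) hβ y y' (IsFreeGroup.of i) g
    rw [← hθ, ← hθ, ← hθ, ← mul_assoc] at h
    rw [← sub_eq_zero] at h ⊢
    rw [← h]
    abel
  have hmulR : ∀ y y' g (v : R), θ (y * y') (g * v) - θ y (g * v) - θ y' (g * v * y) =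
      θ (y * y') g - θ y g - θ y' (g * y) := by
    intro y y' g v
    have h1 := hmul y y' (g * v)
    rw [← hmul y y' g] at h1
    have h2 : equivarianceDefect l y' (g * v * y) = equivarianceDefect l y' (g * y) := by
      have : g * v * y = g * y * (conjNormal y⁻¹ v : R) := by
        simp [mul_assoc]
      rw [this, equivarianceDefect_mul_right hl]
    rw [h2, equivarianceDefect_mul_right hl] at h1
    exact sub_left_injective h1
  have hy : ∀ y g (v : R), η (g * v * y) - η (g * v) - θ y (g * v) = η (g * y) - η g - θ y g := by
    let K : Subgroup G :=
      { carrier := {y | ∀ g (v : R),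
          η (g * v * y) - η (g * v) - θ y (g * v) = η (g * y) - η g - θ y g}
        one_mem' := fun g v => by
          have := hmulR 1 1 g v
          simp only [mul_one, sub_self, zero_sub, neg_inj] at this ⊢
          exact this
        mul_mem' := fun {y y'} h h' g v => by
          have e : g * v * y = g * y * (conjNormal y⁻¹ v : R) := by
            simp [mul_assoc]
          have h1 := h g v
          have h2 := h' (g * y) (conjNormal y⁻¹ v)
          have h3 := hmulR y y' g v
          rw [← e] at h2
          rw [← mul_assoc, ← mul_assoc]
          rw [← sub_eq_zero] at h1 h2 h3 ⊢
          have := congrArg₂ (· + ·) h1 h2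
          have := congrArg₂ (· - ·) this h3
          simp only [add_zero, sub_zero] at this
          rw [← this]
          abel
        inv_mem' := fun {y} h g v => by
          have e : g * v * y⁻¹ = g * y⁻¹ * (conjNormal y v : R) := by
            simp [mul_assoc]
          have h1 := h (g * y⁻¹) (conjNormal y v)
          have h0 := hmulR 1 1 g v
          have h3 := hmulR y⁻¹ y g v
          simp only [mul_one, sub_self, zero_sub, neg_inj, inv_mul_cancel] at h0 h3
          rw [← e, inv_mul_cancel_right, inv_mul_cancel_right] at h1
          rw [← sub_eq_zero] at h0 h1 h3 ⊢
          have := congrArg₂ (· - ·) h1 h3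
          have := congrArg₂ (· + ·) this h0
          simp only [add_zero, sub_zero] at this
          rw [← neg_eq_zero, ← this]
          abel }
    have hK : K = ⊤ := IsFreeGroup.eq_top_of_forall_of_mem K fun i g v => by
      rw [hη, hη, sub_self, sub_self]
    exact fun y => (hK ▸ Subgroup.mem_top y : y ∈ K)
  have hθR : ∀ x y g (v : R), θ y (x * (g * v)) - θ y (g * v) = θ y (x * g) - θ y g := by
    intro x y
    let K : Subgroup G :=
      { carrier := {x | ∀ g (v : R), θ y (x * (g * v)) - θ y (g * v) = θ y (x * g) - θ y g}
        one_mem' := fun g v => by simp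
        mul_mem' := fun {a b} ha hb g v => by
          have h1 := ha (b * g) v
          have h2 := hb g v
          simp only [mul_assoc] at h1 h2 ⊢
          have := congrArg₂ (· + ·) h1 h2
          simpa only [sub_add_sub_cancel] using this
        inv_mem' := fun {a} ha g v => by
          have h1 := ha (a⁻¹ * g) v
          simp only [mul_assoc, mul_inv_cancel_left] at h1 ⊢
          rw [← neg_sub, h1, neg_sub] }
    have hK : K = ⊤ := IsFreeGroup.eq_top_of_forall_of_mem K fun i g v => by
      rw [hθ, hθ, pairingDensity_mul_right hl]
    exact (hK ▸ Subgroup.mem_top x : x ∈ K)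
  have hθw : ∀ (w : R) g, θ w g - (β (l g) w - β w (l g)) =
      θ w 1 - (β (l 1) w - β w (l 1)) := by
    intro w
    apply IsFreeGroup.eq_one_of_left_invariant (fun g => θ w g - (β (l g) w - β w (l g)))
    intro i g
    have h := pairingDensity_of_mem hl hβ w (IsFreeGroup.of i) g
    rw [← hθ] at h
    rw [← sub_eq_zero] at h ⊢
    rw [← h]
    abel
  refine ⟨η, fun x y g v hv => ?_, fun v w => ?_⟩
  · have h1 := hy y (x * g) ⟨v, hv⟩
    have h2 := hy y g ⟨v, hv⟩
    have h3 := hθR x y g ⟨v, hv⟩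
    simp only [mul_assoc] at h1 h2 h3 ⊢
    rw [← sub_eq_zero] at h1 h2 h3 ⊢
    have := congrArg₂ (· + ·) (congrArg₂ (· - ·) h1 h2) h3
    simp only [add_zero, sub_zero] at this
    rw [← this]
    abel
  · have h1 := hy w 1 v
    have h2 := hθw w v
    have h3 : l v = l 1 * v := by rw [← hl, one_mul]
    rw [h3] at h2
    simp only [hβ.mul_left, hβ.mul_right, one_mul] at h1 h2
    rw [← sub_eq_zero] at h1 h2 ⊢
    have := congrArg₂ (· + ·) h1 h2
    simp only [add_zero] at this
    rw [← this]
    abel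

/-! ### Evaluation on the commutator subgroup -/

theorem two_nsmul_eq_zero_of_mem_commutator {G B : Type*} [Group G] [IsFreeGroup G]
    [AddCommGroup B] {R : Subgroup G} [R.Normal] {β : R → R → B} (hβ : IsInvariantPairing R β)
    (cl : commutator R → B) (hmul : ∀ a b, cl (a * b) = cl a + cl b)
    (hcomm : ∀ v w h, cl ⟨⁅v, w⁆, h⟩ = β v w - β w v) (a : commutator R)
    (ha : ∀ η : G → B,
      (∀ x y g : G, ∀ v ∈ R, η (x * g * v * y) - η (x * g * v) - (η (g * v * y) - η (g * v)) =
        η (x * g * y) - η (x * g) - (η (g * y) - η g)) → η a = η 1) :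
    2 • cl a = 0 := by
  obtain ⟨η, hη, hη'⟩ := exists_functional_of_invariantPairing R hβ
  have hquad : ∀ v w : R, η (v * w) - η 1 = (η v - η 1) + (η w - η 1) + (β v w - β w v) := by
    intro v w
    rw [← hη']
    abel
  let f : commutator R →* Multiplicative B :=
    MonoidHom.mk' (fun u => Multiplicative.ofAdd (cl u)) fun u v => by rw [hmul, ofAdd_add]
  have hinv : ∀ a, cl a⁻¹ = -cl a := fun a => congrArg Multiplicative.toAdd (map_inv f a)
  have hone : cl 1 = 0 := congrArg Multiplicative.toAdd (map_one f)
  -- A biadditive `β` vanishes as soon as one argument is in `[R,R]`, so the quadratic term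
  -- disappears.
  have hlin : ∀ a : R, a ∈ commutator R → ∀ b : R,
      η (a * b) - η 1 = (η a - η 1) + (η b - η 1) := by
    intro a ha b
    rw [hquad, (hβ.eq_zero_of_mem_commutator ha b).1, (hβ.eq_zero_of_mem_commutator ha b).2]
    abel
  let K : Subgroup R :=
    { carrier := {a | ∃ h : a ∈ commutator R, η a - η 1 = 2 • cl ⟨a, h⟩}
      one_mem' := ⟨one_mem _, by
        have : (⟨1, one_mem _⟩ : commutator R) = 1 := rfl
        rw [this, hone]; simp⟩
      mul_mem' := fun {a b} ⟨h, h'⟩ ⟨k, k'⟩ => ⟨mul_mem h k, by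
        have : (⟨a * b, mul_mem h k⟩ : commutator R) = ⟨a, h⟩ * ⟨b, k⟩ := rfl
        rw [this, hmul, Subgroup.coe_mul, hlin a h, h', k', smul_add]⟩
      inv_mem' := fun {a} ⟨h, h'⟩ => ⟨inv_mem h, by
        have e : (⟨a⁻¹, inv_mem h⟩ : commutator R) = ⟨a, h⟩⁻¹ := rfl
        have h1 := hlin a h a⁻¹
        rw [← Subgroup.coe_mul, mul_inv_cancel, Subgroup.coe_one, sub_self, h'] at h1
        rw [e, hinv, smul_neg]
        exact (neg_eq_of_add_eq_zero_right h1.symm).symm⟩ }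
  have hK : commutator R ≤ K := by
    rw [commutator_def, Subgroup.commutator_le]
    intro v _ w _
    have hm : ⁅v, w⁆ ∈ commutator R :=
      Subgroup.commutator_mem_commutator (Subgroup.mem_top v) (Subgroup.mem_top w)
    refine ⟨hm, ?_⟩
    -- The factor 2 arises here: from `[v,w] * (w * v) = v * w`, the value at `[v,w]` is `η (v * w)
    -- - η (w * v)`, to which both orders contribute `β v w - β w v`.
    have h1 := hlin ⁅v, w⁆ hm (w * v)
    have h2 : ((⁅v, w⁆ : R) : G) * (w * v : R) = v * w := by
      simp [commutatorElement_def, mul_assoc]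
    rw [h2, hquad, Subgroup.coe_mul, hquad] at h1
    rw [hcomm, two_nsmul]
    rw [← sub_eq_zero] at h1 ⊢
    rw [← neg_eq_zero, ← h1]
    abel
  obtain ⟨h, h'⟩ := hK a.2
  rw [ha η hη, sub_self] at h'
  exact h'.symm

theorem coe_mem_commutator {G : Type*} [Group G] {R : Subgroup G} {a : R} (ha : a ∈ commutator R) :
    (a : G) ∈ ⁅R, R⁆ := by
  rw [← Subgroup.map_subtype_commutator]
  exact ⟨a, ha, rfl⟩

/-- Commutators of elements of `R` are central modulo `[[R,R],G]`, hence form an invariant pairing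
there. Test groups `B` in the universe of `G` suffice, since the one used is the center of that
quotient. -/
theorem pow_four_mem_commutator.{u} {G : Type u} [Group G] [IsFreeGroup G]
    {R : Subgroup G} [R.Normal] (a : commutator R)
    (ha : ∀ (B : Type u) [AddCommGroup B] (η : G → B),
      (∀ x y g : G, ∀ v ∈ R, η (x * g * v * y) - η (x * g * v) - (η (g * v * y) - η (g * v)) =
        η (x * g * y) - η (x * g) - (η (g * y) - η g)) → η a = η 1) :
    (a : G) ^ 4 ∈ ⁅⁅R, R⁆, (⊤ : Subgroup G)⁆ := by
  set N : Subgroup G := ⁅⁅R, R⁆, (⊤ : Subgroup G)⁆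
  have : N.Normal := Subgroup.commutator_normal _ _
  let q : G →* G ⧸ N := QuotientGroup.mk' N
  have hcomm : ∀ c ∈ ⁅R, R⁆, ∀ g, q g * q c = q c * q g := by
    intro c hc g
    have : q ⁅c, g⁆ = 1 :=
      (QuotientGroup.eq_one_iff _).mpr (Subgroup.commutator_mem_commutator hc (Subgroup.mem_top g))
    rw [map_commutatorElement, commutatorElement_eq_one_iff_mul_comm] at this
    exact this.symm
  have hcenter : ∀ c ∈ ⁅R, R⁆, q c ∈ Subgroup.center (G ⧸ N) := by
    intro c hc
    rw [Subgroup.mem_center_iff]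
    intro g
    obtain ⟨g, rfl⟩ := QuotientGroup.mk'_surjective N g
    exact hcomm c hc g
  have hRR : ∀ u v : R, ⁅(u : G), (v : G)⁆ ∈ ⁅R, R⁆ := fun u v =>
    Subgroup.commutator_mem_commutator u.2 v.2
  have hconj : ∀ c ∈ ⁅R, R⁆, ∀ g, q (g * c * g⁻¹) = q c := by
    intro c hc g
    rw [map_mul, map_mul, hcomm c hc, mul_assoc, ← map_mul, mul_inv_cancel, map_one, mul_one]
  let β : R → R → Additive (Subgroup.center (G ⧸ N)) := fun u v =>
    Additive.ofMul ⟨q ⁅(u : G), (v : G)⁆, hcenter _ (hRR u v)⟩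
  have hβ : IsInvariantPairing R β :=
    { mul_left := fun u v w => by
        apply Additive.toMul.injective
        ext
        change q ⁅((u * v : R) : G), (w : G)⁆ = q ⁅(u : G), (w : G)⁆ * q ⁅(v : G), (w : G)⁆
        have : ⁅((u * v : R) : G), (w : G)⁆ =
            u * ⁅(v : G), (w : G)⁆ * (u : G)⁻¹ * ⁅(u : G), (w : G)⁆ := by
          simp only [commutatorElement_def, Subgroup.coe_mul]
          group
        rw [this, map_mul, hconj _ (hRR v w), hcomm _ (hRR u w)]
      mul_right := fun u v w => by
        apply Additive.toMul.injective
        ext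
        change q ⁅(u : G), ((v * w : R) : G)⁆ = q ⁅(u : G), (v : G)⁆ * q ⁅(u : G), (w : G)⁆
        have : ⁅(u : G), ((v * w : R) : G)⁆ =
            ⁅(u : G), (v : G)⁆ * (v * ⁅(u : G), (w : G)⁆ * (v : G)⁻¹) := by
          simp only [commutatorElement_def, Subgroup.coe_mul]
          group
        rw [this, map_mul, hconj _ (hRR u w)]
      conj := fun g u v => by
        apply Additive.toMul.injective
        ext
        change q ⁅((conjNormal g u : R) : G), ((conjNormal g v : R) : G)⁆ = q ⁅(u : G), (v : G)⁆
        have : ⁅((conjNormal g u : R) : G), ((conjNormal g v : R) : G)⁆ =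
            g * ⁅(u : G), (v : G)⁆ * g⁻¹ := by
          simp only [commutatorElement_def, MulAut.conjNormal_apply]
          group
        rw [this, hconj _ (hRR u v)] }
  let ι : commutator R →* Subgroup.center (G ⧸ N) :=
    (q.comp (R.subtype.comp (commutator R).subtype)).codRestrict _
      fun c => hcenter _ (coe_mem_commutator c.2)
  -- Antisymmetry makes `β v w - β w v` equal to `2 • β v w`, hence the coefficient 2 here and the
  -- exponent 4 in the end.
  have key := two_nsmul_eq_zero_of_mem_commutator hβ (fun c => 2 • Additive.ofMul (ι c))
    (fun a b => by rw [map_mul, ofMul_mul, smul_add])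
    (fun v w h => by
      have h1 : Additive.ofMul (ι ⟨⁅v, w⁆, h⟩) = β v w := by
        apply Additive.toMul.injective
        ext
        rfl
      have h2 : β w v = -β v w := by
        apply Additive.toMul.injective
        ext
        change q ⁅(w : G), (v : G)⁆ = (q ⁅(v : G), (w : G)⁆)⁻¹
        rw [← map_inv, commutatorElement_inv]
      rw [h1, h2, two_nsmul, sub_neg_eq_add])
    a (fun η => ha _ η)
  rw [← mul_nsmul, ← ofMul_pow, ofMul_eq_zero, ← map_pow] at key
  have : q ((a : G) ^ 4) = 1 := congrArg Subtype.val key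
  exact (QuotientGroup.eq_one_iff _).mp this

/-! ### Additive functionals on the group ring -/

section

variable {G B : Type*} [Group G] [AddCommGroup B]

/-- The additive extension to `ℤ[G]` of a function on `G`. -/
noncomputable def groupRingExtend (η : G → B) : MonoidAlgebra ℤ G →+ B :=
  (Finsupp.liftAddHom fun g => (zmultiplesHom B (η g))).comp
    MonoidAlgebra.coeffAddEquiv.toAddMonoidHom

theorem groupRingExtend_of (η : G → B) (g : G) :
    groupRingExtend η (MonoidAlgebra.of ℤ G g) = η g := by
  simp [groupRingExtend, MonoidAlgebra.of_apply]

theorem groupRingExtend_grpSubOne (η : G → B) (g : G) :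
    groupRingExtend η (grpSubOne g) = η g - η 1 := by
  rw [grpSubOne, map_sub, groupRingExtend_of, ← map_one (MonoidAlgebra.of ℤ G), groupRingExtend_of]

theorem mem_dimSubgroup {I : Ideal (MonoidAlgebra ℤ G)} {g : G} :
    g ∈ dimSubgroup G I ↔ grpSubOne g ∈ I := Iff.rfl

theorem grpSubOne_mem_relAugIdeal {N : Subgroup G} {n : G} (hn : n ∈ N) :
    grpSubOne n ∈ relAugIdeal N :=
  TwoSidedIdeal.mem_asIdeal.mpr (TwoSidedIdeal.subset_span ⟨n, hn, rfl⟩)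

theorem relAugIdeal_mono {N K : Subgroup G} (h : N ≤ K) : relAugIdeal N ≤ relAugIdeal K := by
  intro x hx
  rw [relAugIdeal, TwoSidedIdeal.mem_asIdeal] at hx ⊢
  exact TwoSidedIdeal.span_mono (by rintro y ⟨n, hn, e⟩; exact ⟨n, h hn, e⟩) hx

instance (N : Subgroup G) : (relAugIdeal N).IsTwoSided := by
  unfold relAugIdeal
  infer_instance

theorem of_mul_grpSubOne (g n : G) :
    MonoidAlgebra.of ℤ G g * grpSubOne n = grpSubOne (g * n * g⁻¹) * MonoidAlgebra.of ℤ G g := by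
  simp only [grpSubOne, mul_sub, sub_mul, ← map_mul, mul_one, one_mul, inv_mul_cancel_right]

theorem grpSubOne_mul_of (g n : G) :
    grpSubOne n * MonoidAlgebra.of ℤ G g = MonoidAlgebra.of ℤ G g * grpSubOne (g⁻¹ * n * g) := by
  rw [of_mul_grpSubOne]
  congr 2
  group

theorem map_mul_mul_eq_zero_of_forall_of {f : MonoidAlgebra ℤ G →+ B} {c : MonoidAlgebra ℤ G}
    (h : ∀ g g', f (MonoidAlgebra.of ℤ G g * c * MonoidAlgebra.of ℤ G g') = 0)
    (x y : MonoidAlgebra ℤ G) : f (x * c * y) = 0 := by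
  induction x using MonoidAlgebra.induction_on with
  | of g =>
    induction y using MonoidAlgebra.induction_on with
    | of g' => exact h g g'
    | add y z hy hz => rw [mul_add, map_add, hy, hz, add_zero]
    | smul r y hy => rw [mul_smul_comm, map_zsmul, hy, smul_zero]
  | add x z hx hz => rw [add_mul, add_mul, map_add, hx, hz, add_zero]
  | smul r x hx => rw [smul_mul_assoc, smul_mul_assoc, map_zsmul, hx, smul_zero]

theorem map_eq_zero_of_mem_relAugIdeal {N : Subgroup G} [hN : N.Normal]
    {f : MonoidAlgebra ℤ G →+ B}
    (h : ∀ g, ∀ n ∈ N, f (MonoidAlgebra.of ℤ G g * grpSubOne n) = 0)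
    {x : MonoidAlgebra ℤ G} (hx : x ∈ relAugIdeal N) : f x = 0 := by
  rw [relAugIdeal, TwoSidedIdeal.mem_asIdeal, TwoSidedIdeal.mem_span_iff_mem_addSubgroup_closure]
    at hx
  refine (AddSubgroup.closure_le f.ker).mpr ?_ hx
  rintro _ ⟨_, ⟨a, -, _, ⟨n, hn, rfl⟩, rfl⟩, b, -, rfl⟩
  refine map_mul_mul_eq_zero_of_forall_of (fun g g' => ?_) a b
  rw [mul_assoc, grpSubOne_mul_of, ← mul_assoc, ← map_mul]
  exact h _ _ (by simpa using hN.conj_mem n hn g'⁻¹)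

theorem map_eq_zero_of_mem_relAugIdeal' {N : Subgroup G} [hN : N.Normal]
    {f : MonoidAlgebra ℤ G →+ B}
    (h : ∀ g, ∀ n ∈ N, f (grpSubOne n * MonoidAlgebra.of ℤ G g) = 0)
    {x : MonoidAlgebra ℤ G} (hx : x ∈ relAugIdeal N) : f x = 0 :=
  map_eq_zero_of_mem_relAugIdeal (fun g n hn => by
    rw [of_mul_grpSubOne]
    exact h _ _ (hN.conj_mem n hn g)) hx

theorem map_eq_zero_of_mem_mul {N K : Subgroup G} [N.Normal] [hK : K.Normal]
    {f : MonoidAlgebra ℤ G →+ B}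
    (h : ∀ g, ∀ n ∈ N, ∀ k ∈ K, f (grpSubOne n * MonoidAlgebra.of ℤ G g * grpSubOne k) = 0)
    {x : MonoidAlgebra ℤ G} (hx : x ∈ relAugIdeal N * relAugIdeal K) : f x = 0 := by
  induction hx using Submodule.mul_induction_on' with
  | mem_mul_mem y hy z hz =>
    refine map_eq_zero_of_mem_relAugIdeal' (f := f.comp (AddMonoidHom.mulRight z))
      (fun g n hn => ?_) hy
    refine map_eq_zero_of_mem_relAugIdeal
      (f := f.comp (AddMonoidHom.mulLeft (grpSubOne n * MonoidAlgebra.of ℤ G g)))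
      (fun g' k hk => ?_) hz
    simp only [AddMonoidHom.comp_apply, AddMonoidHom.coe_mulLeft]
    rw [← mul_assoc, mul_assoc (grpSubOne n), ← map_mul]
    exact h _ n hn k hk
  | add x _ y _ hx hy => rw [map_add, hx, hy, add_zero]

/-- Normality lets group elements be moved past the factors `k - 1`, so one free `g` is enough in
the test products. -/
theorem map_eq_zero_of_mem_mul_mul {N K L : Subgroup G} [N.Normal] [hK : K.Normal] [L.Normal]
    {f : MonoidAlgebra ℤ G →+ B}
    (h : ∀ g, ∀ n ∈ N, ∀ k ∈ K, ∀ l ∈ L,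
      f (grpSubOne n * MonoidAlgebra.of ℤ G g * grpSubOne k * grpSubOne l) = 0)
    {x : MonoidAlgebra ℤ G} (hx : x ∈ relAugIdeal N * relAugIdeal K * relAugIdeal L) :
    f x = 0 := by
  induction hx using Submodule.mul_induction_on' with
  | mem_mul_mem y hy z hz =>
    refine map_eq_zero_of_mem_mul (f := f.comp (AddMonoidHom.mulRight z))
      (fun g n hn k hk => ?_) hy
    refine map_eq_zero_of_mem_relAugIdeal
      (f := f.comp (AddMonoidHom.mulLeft (grpSubOne n * MonoidAlgebra.of ℤ G g * grpSubOne k)))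
      (fun g' l hl => ?_) hz
    simp only [AddMonoidHom.comp_apply, AddMonoidHom.coe_mulLeft]
    rw [← mul_assoc, mul_assoc _ (grpSubOne k), grpSubOne_mul_of _ k, ← mul_assoc,
      mul_assoc (grpSubOne n), ← map_mul]
    exact h _ n hn _ (by simpa using hK.conj_mem k hk g'⁻¹) l hl
  | add x _ y _ hx hy => rw [map_add, hx, hy, add_zero]

theorem mem_of_grpSubOne_mem_relAugIdeal {N : Subgroup G} [N.Normal] {a : G}
    (ha : grpSubOne a ∈ relAugIdeal N) : a ∈ N := by
  classical
  -- The indicator of `N` is left `N`-invariant, so its extension kills `𝐧` and separates `1` from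
  -- elements outside `N`.
  let η : G → ℤ := fun g => if g ∈ N then 1 else 0
  have h := map_eq_zero_of_mem_relAugIdeal' (f := groupRingExtend η) (fun g n hn => by
    rw [grpSubOne, sub_mul, one_mul, ← map_mul, map_sub, groupRingExtend_of, groupRingExtend_of]
    simp [η, Subgroup.mul_mem_cancel_left N hn]) ha
  rw [groupRingExtend_grpSubOne] at h
  by_contra hc
  simp [η, hc] at h

/-- The class of `l g` in the abelianization of `R` changes under `g ↦ g * k`, `k ∈ R`, by the class
of `k` whatever `g` is. Its extension therefore kills the ideal product, while at `a - 1` it gives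
the class of `a`. -/
theorem mem_commutator_of_grpSubOne_mem {N R : Subgroup G} [N.Normal] [R.Normal] {a : G}
    (ha : grpSubOne a ∈ relAugIdeal N * relAugIdeal R) :
    ∃ h : a ∈ R, (⟨a, h⟩ : R) ∈ commutator R := by
  have haR : a ∈ R := mem_of_grpSubOne_mem_relAugIdeal (Ideal.mul_le_right ha)
  refine ⟨haR, ?_⟩
  obtain ⟨l, hl⟩ := R.exists_right_equivariant
  let η : G → Additive (Abelianization R) := fun g => Additive.ofMul (Abelianization.of (l g))
  have h := map_eq_zero_of_mem_mul (f := groupRingExtend η) (fun g n _ k hk => by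
    have h1 := hl g ⟨k, hk⟩
    have h2 := hl (n * g) ⟨k, hk⟩
    simp only at h1 h2
    simp only [grpSubOne, sub_mul, mul_sub, one_mul, mul_one, ← map_mul, map_sub,
      groupRingExtend_of, η, h1, h2]
    simp only [map_mul, ofMul_mul]
    abel) ha
  rw [groupRingExtend_grpSubOne] at h
  have h3 := hl 1 ⟨a, haR⟩
  simp only [one_mul] at h3
  simp only [η, h3, map_mul, ofMul_mul, add_sub_cancel_left, ofMul_eq_zero] at h
  rwa [← Abelianization.ker_of, MonoidHom.mem_ker]

/-- A function on a normal subgroup `H` whose linear extension kills `(x - 1) g (v - 1) (y - 1)`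
for `v ∈ R` is constant on the elements `a` with `a - 1 ∈ 𝐡𝐫𝐡`. -/
theorem eq_of_grpSubOne_mem_mul_mul {H R : Subgroup G} [H.Normal] [R.Normal]
    {a : H} (ha : grpSubOne (a : G) ∈ relAugIdeal H * relAugIdeal R * relAugIdeal H) (hRH : R ≤ H)
    (η : H → B)
    (hη : ∀ x y g : H, ∀ v ∈ R.subgroupOf H,
      η (x * g * v * y) - η (x * g * v) - (η (g * v * y) - η (g * v)) =
        η (x * g * y) - η (x * g) - (η (g * y) - η g)) :
    η a = η 1 := by
  classical
  -- Extension by zero works because all terms of a test product lie in the same coset of `H` as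
  -- `g`.
  let η' : G → B := fun g => if h : g ∈ H then η ⟨g, h⟩ else 0
  have hη' : ∀ g : H, η' g = η g := fun g => by simp [η']
  have h := map_eq_zero_of_mem_mul_mul (f := groupRingExtend η') (fun g n hn k hk l hl => by
    simp only [grpSubOne, sub_mul, mul_sub, one_mul, mul_one, ← map_mul, map_sub,
      groupRingExtend_of]
    by_cases hg : g ∈ H
    · lift g to H using hg
      have hkH : k ∈ H := hRH hk
      lift k to H using hkH
      lift n to H using hn
      lift l to H using hl
      have := hη n l g k hk
      simp only [← Subgroup.coe_mul, hη']
      rw [← sub_eq_zero] at this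
      rw [← this]
      abel
    · have e1 : n * g ∉ H := fun h => hg ((H.mul_mem_cancel_left hn).mp h)
      have e : ∀ u ∉ H, ∀ k ∈ H, u * k ∉ H := fun u hu k hk h =>
        hu ((H.mul_mem_cancel_right hk).mp h)
      have e2 := e _ hg k (hRH hk)
      have e3 := e _ e1 k (hRH hk)
      simp [η', hg, e1, e2, e3, e _ hg l hl, e _ e1 l hl, e _ e2 l hl, e _ e3 l hl]) ha
  rw [groupRingExtend_grpSubOne, hη', ← Subgroup.coe_one H, hη', sub_eq_zero] at h
  exact h

/-! ### The pairing `(u - 1)(v - 1)` modulo an ideal -/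

theorem grpSubOne_mem_of_mem_sup {S T : Subgroup G} {h : G} (hh : h ∈ S ⊔ T) :
    grpSubOne h ∈ relAugIdeal S + relAugIdeal T := by
  have : S ⊔ T ≤ dimSubgroup G (relAugIdeal S + relAugIdeal T) := sup_le
    (fun s hs => Ideal.mem_sup_left (grpSubOne_mem_relAugIdeal hs))
    (fun s hs => Ideal.mem_sup_right (grpSubOne_mem_relAugIdeal hs))
  exact this hh

theorem grpSubOne_mul (u v : G) :
    grpSubOne (u * v) = grpSubOne u + grpSubOne v + grpSubOne u * grpSubOne v := by
  simp only [grpSubOne, map_mul]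
  noncomm_ring

theorem isInvariantPairing_mkQ {H R : Subgroup G} [R.Normal] (hRH : R ≤ H)
    (J : Ideal (MonoidAlgebra ℤ G))
    (hJ₁ : ∀ u ∈ R, ∀ v ∈ R, ∀ g ∈ H, grpSubOne u * grpSubOne v * grpSubOne g ∈ J)
    (hJ₂ : ∀ u ∈ R, ∀ v ∈ R, ∀ g ∈ H, grpSubOne g * grpSubOne u * grpSubOne v ∈ J) :
    IsInvariantPairing (R.subgroupOf H) fun u v =>
      J.mkQ (grpSubOne ((u : H) : G) * grpSubOne ((v : H) : G)) where
  mul_left u v w := by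
    rw [← map_add, ← sub_eq_zero, ← map_sub, Submodule.mkQ_apply, Submodule.Quotient.mk_eq_zero]
    convert hJ₁ u u.2 v v.2 w (hRH w.2) using 1
    simp only [Subgroup.coe_mul, grpSubOne_mul]
    noncomm_ring
  mul_right u v w := by
    rw [← map_add, ← sub_eq_zero, ← map_sub, Submodule.mkQ_apply, Submodule.Quotient.mk_eq_zero]
    convert hJ₁ u u.2 v v.2 w (hRH w.2) using 1
    simp only [Subgroup.coe_mul, grpSubOne_mul]
    noncomm_ring
  conj g u v := by
    rw [← sub_eq_zero, ← map_sub, Submodule.mkQ_apply, Submodule.Quotient.mk_eq_zero]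
    -- With `p = (u - 1)(v - 1)`, the identity is `g p g⁻¹ - p = g p (g⁻¹ - 1) + (g - 1) p`.
    have h1 := J.add_mem (J.mul_mem_left (MonoidAlgebra.of ℤ G g)
      (hJ₁ u u.2 v v.2 _ (inv_mem g.2))) (hJ₂ u u.2 v v.2 g g.2)
    convert h1 using 1
    have e : ∀ u : R.subgroupOf H, grpSubOne (((conjNormal g u : R.subgroupOf H) : H) : G) =
        MonoidAlgebra.of ℤ G g * grpSubOne ((u : H) : G) * MonoidAlgebra.of ℤ G (g : G)⁻¹ := by
      intro u
      rw [of_mul_grpSubOne, mul_assoc, ← map_mul, mul_inv_cancel, map_one, mul_one]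
      simp
    have e2 : MonoidAlgebra.of ℤ G (g : G)⁻¹ * MonoidAlgebra.of ℤ G (g : G) = 1 := by
      rw [← map_mul, inv_mul_cancel, map_one]
    rw [e, e]
    have e3 : ∀ p q : MonoidAlgebra ℤ G,
        MonoidAlgebra.of ℤ G (g : G) * p * MonoidAlgebra.of ℤ G (g : G)⁻¹ *
          (MonoidAlgebra.of ℤ G (g : G) * q * MonoidAlgebra.of ℤ G (g : G)⁻¹) =
        MonoidAlgebra.of ℤ G (g : G) * p * q * MonoidAlgebra.of ℤ G (g : G)⁻¹ := by
      intro p q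
      rw [mul_assoc (_ * p), ← mul_assoc _ (_ * q), ← mul_assoc _ _ q, e2, one_mul, ← mul_assoc]
    rw [e3, grpSubOne, grpSubOne, grpSubOne, grpSubOne]
    noncomm_ring

/-- If `a - 1 ∈ 𝐡𝐫𝐡`, then `a ^ 2 - 1` lies in every left ideal that contains all products
`(u - 1) (v - 1) (g - 1)` and `(g - 1) (u - 1) (v - 1)` with `u, v ∈ R` and `g ∈ H`. -/
theorem grpSubOne_sq_mem [IsFreeGroup G] {H R : Subgroup G} [H.Normal] [R.Normal] (hRH : R ≤ H)
    (J : Ideal (MonoidAlgebra ℤ G))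
    (hJ₁ : ∀ u ∈ R, ∀ v ∈ R, ∀ g ∈ H, grpSubOne u * grpSubOne v * grpSubOne g ∈ J)
    (hJ₂ : ∀ u ∈ R, ∀ v ∈ R, ∀ g ∈ H, grpSubOne g * grpSubOne u * grpSubOne v ∈ J)
    (a : commutator (R.subgroupOf H))
    (ha : grpSubOne (((a : R.subgroupOf H) : H) : G) ∈
      relAugIdeal H * relAugIdeal R * relAugIdeal H) :
    grpSubOne ((((a : R.subgroupOf H) : H) : G) ^ 2) ∈ J := by
  have hβ := isInvariantPairing_mkQ hRH J hJ₁ hJ₂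
  have hmul : ∀ u v : R.subgroupOf H, J.mkQ (grpSubOne (((u * v : R.subgroupOf H) : H) : G)) =
      J.mkQ (grpSubOne ((u : H) : G)) + J.mkQ (grpSubOne ((v : H) : G)) +
        J.mkQ (grpSubOne ((u : H) : G) * grpSubOne ((v : H) : G)) := fun u v => by
    rw [← map_add, ← map_add, ← grpSubOne_mul]
    rfl
  have key := two_nsmul_eq_zero_of_mem_commutator hβ
    (fun c => J.mkQ (grpSubOne (((c : R.subgroupOf H) : H) : G)))
    (fun c d => by
      rw [Subgroup.coe_mul, hmul, (hβ.eq_zero_of_mem_commutator c.2 d).1, add_zero])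
    (fun v w h => by
      have h1 := hmul ⁅v, w⁆ (w * v)
      rw [(hβ.eq_zero_of_mem_commutator h (w * v)).1, add_zero] at h1
      have h2 : ⁅v, w⁆ * (w * v) = v * w := by simp [commutatorElement_def, mul_assoc]
      rw [h2, hmul, hmul] at h1
      rw [← sub_eq_zero] at h1 ⊢
      rw [← neg_eq_zero, ← h1]
      abel)
    a (fun η hη => eq_of_grpSubOne_mem_mul_mul ha hRH η hη)
  -- Since `a ∈ [R,R]`, the pairing vanishes at `(a, a)`, so `a ^ 2 - 1 ≡ 2 (a - 1)` modulo `J`.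
  rw [← Submodule.Quotient.mk_eq_zero, ← Submodule.mkQ_apply, ← key, two_nsmul, pow_two]
  have := hmul (a : R.subgroupOf H) a
  rw [(hβ.eq_zero_of_mem_commutator a.2 a).1, add_zero] at this
  exact this

end

/-! ### The main theorem -/

theorem mainTheorem6 {F : Type*} [Group F] [IsFreeGroup F] (R S T : Subgroup F)
    [R.Normal] [S.Normal] [T.Normal] (hRS : R ≤ S) (hRT : R ≤ T) (a : F)
    (ha : a ∈ dimSubgroup F
      (relAugIdeal S * relAugIdeal R * relAugIdeal S +
        relAugIdeal T * relAugIdeal R * relAugIdeal T)) :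
    a ^ 2 ∈ dimSubgroup F
      (relAugIdeal R * relAugIdeal R * relAugIdeal S +
        relAugIdeal S * relAugIdeal R * relAugIdeal R +
        relAugIdeal R * relAugIdeal R * relAugIdeal T +
        relAugIdeal T * relAugIdeal R * relAugIdeal R) ∧
    a ^ 4 ∈ ⁅⁅R, R⁆, S ⊔ T⁆ := by
  set H := S ⊔ T with hH
  have hRH : R ≤ H := hRS.trans le_sup_left
  have hS : relAugIdeal S ≤ relAugIdeal H := relAugIdeal_mono le_sup_left
  have hT : relAugIdeal T ≤ relAugIdeal H := relAugIdeal_mono le_sup_right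
  have ha1 : grpSubOne a ∈ relAugIdeal H * relAugIdeal R * relAugIdeal H :=
    (sup_le (Ideal.mul_mono (Ideal.mul_mono hS le_rfl) hS)
      (Ideal.mul_mono (Ideal.mul_mono hT le_rfl) hT) : _ ≤ _) ha
  have ha2 : grpSubOne a ∈ relAugIdeal H * relAugIdeal R := by
    rw [Ideal.mul_assoc] at ha1
    exact Ideal.mul_mono le_rfl Ideal.mul_le_left ha1
  obtain ⟨haR, hac⟩ := mem_commutator_of_grpSubOne_mem ha2
  have hmap : (R.subgroupOf H).map H.subtype = R := Subgroup.map_subgroupOf_eq_of_le hRH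
  have hcomm : ⁅R.subgroupOf H, R.subgroupOf H⁆.map H.subtype = ⁅R, R⁆ := by
    rw [Subgroup.map_commutator, hmap]
  have haRR : a ∈ ⁅R, R⁆ := coe_mem_commutator hac
  -- The functional is constructed on the free group `H` rather than on `F`, so `a` is rewritten as
  -- an element of the commutator subgroup of `R` viewed inside `H`.
  obtain ⟨b, ⟨c, hc, rfl⟩, rfl⟩ : ∃ b ∈ (commutator (R.subgroupOf H)).map (R.subgroupOf H).subtype,
      H.subtype b = a := by
    rw [Subgroup.map_subtype_commutator]
    rwa [← hcomm] at haRR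
  constructor
  · rw [mem_dimSubgroup]
    refine grpSubOne_sq_mem hRH _ (fun u hu v hv g hg => ?_) (fun u hu v hv g hg => ?_) ⟨c, hc⟩ ha1
    · have h := Ideal.mul_mem_mul (Ideal.mul_mem_mul (grpSubOne_mem_relAugIdeal hu)
        (grpSubOne_mem_relAugIdeal hv)) (grpSubOne_mem_of_mem_sup hg)
      rw [mul_add] at h
      refine sup_le (α := Ideal (MonoidAlgebra ℤ F)) ?_ ?_ h
      · exact le_sup_left.trans (le_sup_left.trans le_sup_left)
      · exact le_sup_right.trans le_sup_left
    · have h := Ideal.mul_mem_mul (Ideal.mul_mem_mul (grpSubOne_mem_of_mem_sup hg)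
        (grpSubOne_mem_relAugIdeal hu)) (grpSubOne_mem_relAugIdeal hv)
      rw [add_mul, add_mul] at h
      refine sup_le (α := Ideal (MonoidAlgebra ℤ F)) ?_ ?_ h
      · exact le_sup_right.trans (le_sup_left.trans le_sup_left)
      · exact le_sup_right
  · have h4 := pow_four_mem_commutator (R := R.subgroupOf H) ⟨c, hc⟩
      (fun B _ η hη => eq_of_grpSubOne_mem_mul_mul ha1 hRH η hη)
    have h5 := Subgroup.mem_map_of_mem H.subtype h4
    rw [Subgroup.map_commutator, hcomm, ← MonoidHom.range_eq_map, H.range_subtype] at h5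
    simpa using h5
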